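/- Let $n\ge 1$ and let $\triangle=\{(x_1,\dots,x_n)\in\mathbb R^n : 1\ge x_1\ge\cdots\ge x_n\ge 0\}$. For each integer $b\ge 0$ put $$\triangle_b=\{x\in\triangle : 1-x_1-b\,x_n\ge 0>1-x_1-(b+1)\,x_n\},$$ and let the triangle map $T$ be given on $\triangle_b$ by $$T(x_1,\dots,x_n)=\Bigl(\frac{x_2}{x_1},\dots,\frac{x_n}{x_1},\frac{1-x_1-b\,x_n}{x_1}\Bigr),\qquad b=\Bigl\lfloor\frac{1-x_1}{x_n}\Bigr\rfloor .$$ A triangle sequence of $x\in\triangle$ is an infinite sequence $(b_0,b_1,\dots)$ of non-negative integers with $T^{k}(x)\in\triangle_{b_k}$ for all $k\ge 0$, and the cylinders of such a sequence are $$\triangle(b_0,\dots,b_m)=\{y : T^{k}(y)\in\triangle_{b_k}\text{ for } 0\le k\le m\}.$$ Then for Lebesgue-almost every $x\in\triangle$ the triangle map converges weakly at $x$: the point $x$ has a triangle sequence $(b_0,b_1,\dots)$, and the nested cylinders $\triangle(b_0,\dots,b_m)$ converge to $\{x\}$ as $m\to\infty$, that is, $\bigcap_{m\ge 0}\triangle(b_0,\dots,b_m)=\{x\}$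 and every neighbourhood of $x$ contains $\triangle(b_0,\dots,b_m)$ for all sufficiently large $m$. -/

import Mathlib

open Set Filter Topology MeasureTheory

namespace TriangleMap

/- The ambient space of dimension `n = d + 1 ≥ 1` is `Fin (d + 1) → ℝ`; the coordinates
`x₁, …, xₙ` are `x 0, …, x (Fin.last d)`. -/

/-- The simplex `△ = {x ∈ ℝⁿ : 1 ≥ x₁ ≥ ⋯ ≥ xₙ ≥ 0}`. -/
def simplex (d : ℕ) : Set (Fin (d + 1) → ℝ) :=
  {x | x 0 ≤ 1 ∧ Antitone x ∧ 0 ≤ x (Fin.last d)}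

/-- The piece `△_b = {x ∈ △ : 1 - x₁ - b xₙ ≥ 0 > 1 - x₁ - (b + 1) xₙ}`. -/
def subsimplex (d : ℕ) (b : ℕ) : Set (Fin (d + 1) → ℝ) :=
  {x | x ∈ simplex d ∧ 0 ≤ 1 - x 0 - (b : ℝ) * x (Fin.last d) ∧
    1 - x 0 - ((b : ℝ) + 1) * x (Fin.last d) < 0}

/-- The digit `b = ⌊(1 - x₁) / xₙ⌋` of a point. It is meaningful on the union of the pieces `△_b`,
that is, on the points of `△` with `xₙ > 0`. -/
noncomputable def digit (d : ℕ) (x : Fin (d + 1) → ℝ) : ℕ :=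
  ⌊(1 - x 0) / x (Fin.last d)⌋₊

/-- The triangle map
`T (x₁, …, xₙ) = (x₂ / x₁, …, xₙ / x₁, (1 - x₁ - b xₙ) / x₁)` for `x ∈ △_b`. -/
noncomputable def triangleMap (d : ℕ) (x : Fin (d + 1) → ℝ) : Fin (d + 1) → ℝ :=
  Fin.snoc (α := fun _ => ℝ) (fun i : Fin d => x i.succ / x 0)
    ((1 - x 0 - (digit d x : ℝ) * x (Fin.last d)) / x 0)

/-- `b` is the triangle sequence of `x`: `x ∈ △_{b₀}`, `T x ∈ △_{b₁}`, `T² x ∈ △_{b₂}`, …. -/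
def IsTriangleSequence (d : ℕ) (x : Fin (d + 1) → ℝ) (b : ℕ → ℕ) : Prop :=
  ∀ k : ℕ, (triangleMap d)^[k] x ∈ subsimplex d (b k)

/-- The cylinder `△(b₀, …, b_m)`. -/
def cylinder (d : ℕ) (b : ℕ → ℕ) (m : ℕ) : Set (Fin (d + 1) → ℝ) :=
  {x | ∀ k ≤ m, (triangleMap d)^[k] x ∈ subsimplex d (b k)}

/-- The triangle map converges weakly at `x`: the point `x` has an infinite triangle sequence
`(b₀, b₁, …)`, and the nested cylinders `△(b₀, …, b_m)` converge to `{x}` as `m → ∞`, both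
set-theoretically (their intersection is `{x}`) and topologically (they are eventually contained
in every neighbourhood of `x`). -/
def WeaklyConvergesAt (d : ℕ) (x : Fin (d + 1) → ℝ) : Prop :=
  ∃ b : ℕ → ℕ, IsTriangleSequence d x b ∧ (⋂ m : ℕ, cylinder d b m) = {x} ∧
    ∀ U ∈ 𝓝 x, ∀ᶠ m : ℕ in atTop, cylinder d b m ⊆ U

/-- On the piece `△_b` the digit is `b`. -/
theorem digit_eq_of_mem_subsimplex {d b : ℕ} {x : Fin (d + 1) → ℝ} (hx : x ∈ subsimplex d b) :
    digit d x = b := by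
  obtain ⟨⟨h1, -, h0⟩, h2, h3⟩ := hx
  have hpos : 0 < x (Fin.last d) := by
    rcases h0.lt_or_eq with h | h
    · exact h
    · rw [← h] at h2 h3
      linarith
  unfold digit
  rw [Nat.floor_eq_iff (div_nonneg (by linarith) h0), le_div_iff₀ hpos, div_lt_iff₀ hpos]
  constructor <;> linarith

/-- The triangle map sends each piece `△_b` into `△`. -/
theorem triangleMap_mem_simplex {d b : ℕ} {x : Fin (d + 1) → ℝ} (hx : x ∈ subsimplex d b) :
    triangleMap d x ∈ simplex d := by
  have hb := digit_eq_of_mem_subsimplex hx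
  obtain ⟨⟨h1, ha, h0⟩, h2, h3⟩ := hx
  have hpos : 0 < x (Fin.last d) := by
    rcases h0.lt_or_eq with h | h
    · exact h
    · rw [← h] at h2 h3
      linarith
  have h00 : 0 < x 0 := hpos.trans_le (ha (Fin.zero_le _))
  have hlast : triangleMap d x (Fin.last d) =
      (1 - x 0 - (b : ℝ) * x (Fin.last d)) / x 0 := by
    simp [triangleMap, hb]
  have hcast : ∀ i : Fin d, triangleMap d x i.castSucc = x i.succ / x 0 := by
    intro i
    simp [triangleMap]
  have hle : triangleMap d x (Fin.last d) ≤ x (Fin.last d) / x 0 := by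
    rw [hlast]
    exact div_le_div_of_nonneg_right (by linarith) h00.le
  have hanti : Antitone (triangleMap d x) := by
    intro i j hij
    induction j using Fin.lastCases with
    | last =>
      induction i using Fin.lastCases with
      | last => exact le_rfl
      | cast i =>
        rw [hcast]
        exact hle.trans (div_le_div_of_nonneg_right (ha (Fin.le_last _)) h00.le)
    | cast j =>
      induction i using Fin.lastCases with
      | last => exact absurd hij (not_le.mpr (Fin.castSucc_lt_last j))
      | cast i =>
        rw [hcast, hcast]
        exact div_le_div_of_nonneg_right
          (ha (Fin.succ_le_succ_iff.mpr (Fin.castSucc_le_castSucc_iff.mp hij))) h00.le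
  refine ⟨?_, hanti, ?_⟩
  · induction d with
    | zero =>
      exact hle.trans ((div_le_one h00).mpr (ha (Fin.zero_le _)))
    | succ d _ =>
      have := hcast 0
      rw [Fin.castSucc_zero] at this
      rw [this]
      exact (div_le_one h00).mpr (ha (Fin.zero_le _))
  · rw [hlast]
    exact div_nonneg h2 h00.le

end TriangleMap

/-! For `x` in the simplex, the entries of `gaps x` are barycentric coordinates. In them each
inverse branch of the map is, up to a positive factor, a nonnegative matrix `branch b` of
determinant ±1. On a cylinder, the coordinate `y j` is thus a quotient of two functionals, the
evolved rows `tailRow d j` and `1`, at the differences of a later iterate of `y`. A block of `2 * d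
+ 3` zero digits acts by a positive matrix and brings these rows closer to proportionality by a
fixed factor (`exists_pinch_zero_block`), so infinitely many blocks shrink the cylinders to a point.

It remains to see that almost every orbit meets such blocks infinitely often. Preimages of null sets
are null, so it is enough that the forward invariant set `noZeroBlock d` is null. The part of its
cone where `q ⬝ᵥ u < 1` has volume at most `weight q`, and `weight q` is the sum of the weights of
the successors `rowStep b q` (`hasSum_weight_rowStep`), so weights behave like transition
probabilities. From any increasing row, a share of the weight bounded below reaches rows with
comparable entries and then passes through a zero block. Hence a bound `H * weight q` improves to
`(1 - ε) * H * weight q` with `ε` depending only on `d` (`exists_coneVol_noZeroBlock_le`), and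
iteration gives zero. -/

namespace TriangleMap

/-! ### Linearisation of the map on difference vectors -/

/-- The successive differences `(1 - x₁, x₁ - x₂, …, xₙ₋₁ - xₙ, xₙ)`. -/
def gaps {d : ℕ} (x : Fin (d + 1) → ℝ) : Fin (d + 2) → ℝ :=
  fun i => Fin.cons (α := fun _ => ℝ) 1 x i - Fin.snoc (α := fun _ => ℝ) x 0 i

/-- The linear inverse branch of the triangle map with digit `b`, on vectors of differences. -/
def branch {d : ℕ} (b : ℕ) (v : Fin (d + 2) → ℝ) : Fin (d + 2) → ℝ :=
  Fin.cons (α := fun _ => ℝ)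
    (b * (v (Fin.last d).castSucc + v (Fin.last (d + 1))) + v (Fin.last (d + 1)))
    (Fin.snoc (α := fun _ => ℝ) (fun i : Fin d => v i.castSucc.castSucc)
      (v (Fin.last d).castSucc + v (Fin.last (d + 1))))

/-- The transpose of `branch b`, acting on row vectors. -/
def rowStep {d : ℕ} (b : ℕ) (q : Fin (d + 2) → ℝ) : Fin (d + 2) → ℝ :=
  Fin.snoc (α := fun _ => ℝ)
    (Fin.snoc (α := fun _ => ℝ) (fun i : Fin d => q i.castSucc.succ)
      (q (Fin.last (d + 1)) + b * q 0))
    (q (Fin.last (d + 1)) + (b + 1) * q 0)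

section Rows

variable {d : ℕ} (b : ℕ) (q r v : Fin (d + 2) → ℝ)

@[simp] theorem rowStep_last :
    rowStep b q (Fin.last (d + 1)) = q (Fin.last (d + 1)) + (b + 1) * q 0 := by
  simp [rowStep]

@[simp] theorem rowStep_last_castSucc :
    rowStep b q (Fin.last d).castSucc = q (Fin.last (d + 1)) + b * q 0 := by
  simp only [rowStep, Fin.snoc_castSucc, Fin.snoc_last]

@[simp] theorem rowStep_castSucc_castSucc (i : Fin d) :
    rowStep b q i.castSucc.castSucc = q i.castSucc.succ := by
  simp only [rowStep, Fin.snoc_castSucc]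

theorem dotProduct_branch : q ⬝ᵥ branch b v = rowStep b q ⬝ᵥ v := by
  simp only [dotProduct]
  rw [Fin.sum_univ_succ, Fin.sum_univ_castSucc, Fin.sum_univ_castSucc, Fin.sum_univ_castSucc]
  simp only [branch, Fin.cons_zero, Fin.cons_succ, Fin.snoc_castSucc, Fin.snoc_last,
    rowStep_last, rowStep_last_castSucc, rowStep_castSucc_castSucc]
  rw [Fin.succ_last]
  ring

theorem rowStep_sub : rowStep b (q - r) = rowStep b q - rowStep b r := by
  ext i
  induction i using Fin.lastCases with
  | last => simp; ring
  | cast i =>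
    induction i using Fin.lastCases with
    | last => simp; ring
    | cast i => simp

theorem rowStep_smul (c : ℝ) : rowStep b (c • q) = c • rowStep b q := by
  ext i
  induction i using Fin.lastCases with
  | last => simp; ring
  | cast i =>
    induction i using Fin.lastCases with
    | last => simp; ring
    | cast i => simp

variable {q}

theorem rowStep_nonneg (hq : 0 ≤ q) : 0 ≤ rowStep b q := by
  intro i
  have h0 := hq 0
  have h1 := hq (Fin.last (d + 1))
  simp only [Pi.zero_apply] at h0 h1
  induction i using Fin.lastCases with
  | last => simp; positivity
  | cast i =>
    induction i using Fin.lastCases with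
    | last => simp; positivity
    | cast i => simpa using hq _

theorem rowStep_pos (hq : ∀ i, 0 < q i) (i : Fin (d + 2)) : 0 < rowStep b q i := by
  have h0 := hq 0
  have h1 := hq (Fin.last (d + 1))
  induction i using Fin.lastCases with
  | last => simp; positivity
  | cast i =>
    induction i using Fin.lastCases with
    | last => simp; positivity
    | cast i => simpa using hq _

/-- The volume estimates need rows whose first entry is least and whose last entry is greatest, so
this order has to survive each step. -/
theorem rowStep_monotone (h0 : 0 ≤ q 0) (hq : Monotone q) : Monotone (rowStep b q) := by
  rw [Fin.monotone_iff_le_succ]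
  intro i
  induction i using Fin.lastCases with
  | last => simp; linarith
  | cast i =>
    rw [rowStep_castSucc_castSucc, Fin.succ_castSucc]
    rcases Fin.eq_castSucc_or_eq_last i.succ with ⟨j, hj⟩ | hj
    · rw [hj, rowStep_castSucc_castSucc, ← hj]
      exact hq (by simp [Fin.le_def])
    · rw [hj, rowStep_last_castSucc]
      have : q (Fin.last d).castSucc ≤ q (Fin.last (d + 1)) := hq (Fin.le_last _)
      have : 0 ≤ (b : ℝ) * q 0 := by positivity
      linarith

end Rows

/-- `branch b` as a composition of two shears and a cyclic permutation. -/
noncomputable def branchLin (d b : ℕ) : (Fin (d + 2) → ℝ) →ₗ[ℝ] (Fin (d + 2) → ℝ) :=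
  Matrix.toLin' (Equiv.Perm.permMatrix ℝ (finRotate (d + 2)).symm) ∘ₗ
    LinearMap.transvection ((b : ℝ) • LinearMap.proj (Fin.last d).castSucc)
      (Pi.single (Fin.last (d + 1)) 1) ∘ₗ
    LinearMap.transvection (LinearMap.proj (Fin.last (d + 1)))
      (Pi.single (Fin.last d).castSucc 1)

theorem abs_det_branchLin (d b : ℕ) : |LinearMap.det (branchLin d b)| = 1 := by
  have h : (Fin.last d).castSucc ≠ Fin.last (d + 1) := (Fin.castSucc_lt_last _).ne
  rw [branchLin, LinearMap.det_comp, LinearMap.det_comp, LinearMap.det_toLin',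
    Matrix.det_permutation, LinearMap.transvection.det, LinearMap.transvection.det]
  simp [h, h.symm]

theorem branchLin_apply (d b : ℕ) (v : Fin (d + 2) → ℝ) : branchLin d b v = branch b v := by
  have h : (Fin.last d).castSucc ≠ Fin.last (d + 1) := (Fin.castSucc_lt_last _).ne
  have hs : ∀ i : Fin (d + 1), (finRotate (d + 2)).symm i.succ = i.castSucc := by
    intro i
    rw [Equiv.symm_apply_eq, finRotate_apply, Fin.coeSucc_eq_succ]
  have h0 : (finRotate (d + 2)).symm 0 = Fin.last (d + 1) := by
    rw [Equiv.symm_apply_eq, finRotate_last]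
  ext i
  simp only [branchLin, LinearMap.comp_apply, Matrix.toLin'_apply, Matrix.permMatrix_mulVec,
    LinearMap.transvection.apply, Function.comp_apply]
  induction i using Fin.cases with
  | zero => simp [h0, branch, h.symm]; ring
  | succ i =>
    rw [hs]
    induction i using Fin.lastCases with
    | last => simp [branch, h, -Fin.succ_last]
    | cast i =>
      have h1 : i.castSucc.castSucc ≠ Fin.last (d + 1) := (Fin.castSucc_lt_last _).ne
      have h2 : i.castSucc.castSucc ≠ (Fin.last d).castSucc := by
        simp [(Fin.castSucc_lt_last i).ne]
      simp [branch, h1, h2]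

theorem volume_image_branch (d b : ℕ) (s : Set (Fin (d + 2) → ℝ)) :
    volume (branch b '' s) = volume s := by
  have : branch (d := d) b = branchLin d b := by
    ext1 v
    rw [branchLin_apply]
  rw [this, Measure.addHaar_image_linearMap, abs_det_branchLin]
  simp

section Gaps

variable {d : ℕ} (x : Fin (d + 1) → ℝ)

@[simp] theorem gaps_zero : gaps x 0 = 1 - x 0 := by
  have : (0 : Fin (d + 2)) = (0 : Fin (d + 1)).castSucc := rfl
  unfold gaps
  rw [Fin.cons_zero, this, Fin.snoc_castSucc]

@[simp] theorem gaps_last : gaps x (Fin.last (d + 1)) = x (Fin.last d) := by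
  unfold gaps
  rw [Fin.snoc_last, ← Fin.succ_last, Fin.cons_succ, sub_zero]

@[simp] theorem gaps_castSucc_succ (i : Fin d) :
    gaps x i.castSucc.succ = x i.castSucc - x i.succ := by
  unfold gaps
  rw [Fin.cons_succ, Fin.succ_castSucc, Fin.snoc_castSucc]

variable {x}

theorem gaps_nonneg (hx : x ∈ simplex d) : 0 ≤ gaps x := by
  intro i
  induction i using Fin.cases with
  | zero => simpa using hx.1
  | succ i =>
    induction i using Fin.lastCases with
    | last => simpa using hx.2.2
    | cast i => rw [gaps_castSucc_succ]; simpa using hx.2.1 (by simp [Fin.le_def])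

theorem mem_subsimplex_digit (hx : x ∈ simplex d) (h : 0 < x (Fin.last d)) :
    x ∈ subsimplex d (digit d x) := by
  have h1 : 0 ≤ (1 - x 0) / x (Fin.last d) := div_nonneg (by linarith [hx.1]) h.le
  have h2 := Nat.floor_le h1
  have h3 := Nat.lt_floor_add_one ((1 - x 0) / x (Fin.last d))
  rw [le_div_iff₀ h] at h2
  rw [div_lt_iff₀ h] at h3
  refine ⟨hx, ?_, ?_⟩ <;> unfold digit <;> linarith

theorem last_pos_of_mem_subsimplex {b : ℕ} (hx : x ∈ subsimplex d b) : 0 < x (Fin.last d) := by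
  obtain ⟨⟨-, -, h0⟩, h2, h3⟩ := hx
  rcases h0.lt_or_eq with h | h
  · exact h
  · rw [← h] at h2 h3
    linarith

theorem zero_pos_of_mem_subsimplex {b : ℕ} (hx : x ∈ subsimplex d b) : 0 < x 0 :=
  (last_pos_of_mem_subsimplex hx).trans_le (hx.1.2.1 (Fin.zero_le _))

/-- On a piece, division by `x 0` is the only nonlinearity of the map; factoring it out leaves a
matrix relation. -/
theorem gaps_eq_smul_branch {b : ℕ} (hx : x ∈ subsimplex d b) :
    gaps x = x 0 • branch b (gaps (triangleMap d x)) := by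
  have h0 := (zero_pos_of_mem_subsimplex hx).ne'
  have hb := digit_eq_of_mem_subsimplex hx
  have hlast : triangleMap d x (Fin.last d) =
      (1 - x 0 - (b : ℝ) * x (Fin.last d)) / x 0 := by
    simp [triangleMap, hb]
  have hcast : ∀ i : Fin d, triangleMap d x i.castSucc = x i.succ / x 0 := by
    intro i
    simp [triangleMap]
  have hz : ∀ i : Fin (d + 1), Fin.cons (α := fun _ => ℝ) 1 (triangleMap d x) i.castSucc
      = x i / x 0 := by
    intro i
    induction i using Fin.cases with
    | zero => simp [h0]
    | succ i => rw [← Fin.succ_castSucc, Fin.cons_succ, hcast]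
  have hs : gaps (triangleMap d x) (Fin.last d).castSucc
      + gaps (triangleMap d x) (Fin.last (d + 1)) = x (Fin.last d) / x 0 := by
    rw [gaps_last]
    unfold gaps
    rw [hz, Fin.snoc_castSucc]
    ring
  ext i
  rw [Pi.smul_apply, smul_eq_mul]
  unfold branch
  rw [hs, gaps_last, hlast]
  induction i using Fin.cases with
  | zero => rw [gaps_zero, Fin.cons_zero]; field_simp; ring
  | succ i =>
    rw [Fin.cons_succ]
    induction i using Fin.lastCases with
    | last => rw [Fin.snoc_last, Fin.succ_last, gaps_last]; field_simp
    | cast i =>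
      rw [Fin.snoc_castSucc, gaps_castSucc_succ]
      unfold gaps
      rw [hz, Fin.snoc_castSucc, hcast]
      field_simp

end Gaps

/-! ### Contraction by a block of zero digits -/

section ZeroBlock

variable {d : ℕ} {q : Fin (d + 2) → ℝ}

theorem succ_le_rowStep_castSucc (b : ℕ) (hq : 0 ≤ q) (i : Fin (d + 1)) :
    q i.succ ≤ rowStep b q i.castSucc := by
  induction i using Fin.lastCases with
  | last =>
    have : 0 ≤ (b : ℝ) * q 0 := mul_nonneg b.cast_nonneg (hq 0)
    rw [rowStep_last_castSucc, Fin.succ_last]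
    linarith
  | cast i => rw [rowStep_castSucc_castSucc]

theorem iterate_rowStep_nonneg (b k : ℕ) (hq : 0 ≤ q) : 0 ≤ (rowStep b)^[k] q := by
  induction k with
  | zero => exact hq
  | succ k ih => rw [Function.iterate_succ_apply']; exact rowStep_nonneg b ih

theorem le_iterate_rowStep_last (k : ℕ) (hq : 0 ≤ q) :
    q (Fin.last (d + 1)) ≤ (rowStep 0)^[k] q (Fin.last (d + 1)) := by
  induction k with
  | zero => exact le_rfl
  | succ k ih =>
    have := iterate_rowStep_nonneg 0 k hq 0
    rw [Function.iterate_succ_apply', rowStep_last]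
    simp only [Pi.zero_apply] at this
    push_cast
    linarith

/-- A step with digit zero shifts entries one place to the left, so entry `i` reaches place `0`
after `i` steps and is added to the last entry at the next one. -/
theorem le_iterate_rowStep_succ_last (i : ℕ) (hi : i < d + 2) (hq : 0 ≤ q) :
    q ⟨i, hi⟩ ≤ (rowStep 0)^[i + 1] q (Fin.last (d + 1)) := by
  induction i generalizing q with
  | zero =>
    have h := hq (Fin.last (d + 1))
    simp only [Pi.zero_apply] at h
    change q 0 ≤ rowStep 0 q (Fin.last (d + 1))
    rw [rowStep_last]
    push_cast
    linarith
  | succ i ih =>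
    rw [Function.iterate_succ_apply]
    exact (succ_le_rowStep_castSucc 0 hq ⟨i, by lia⟩).trans
      (ih (by lia) (rowStep_nonneg 0 hq))

theorem last_le_iterate_rowStep (k : ℕ) (hq : 0 ≤ q) (i : Fin (d + 2)) (hi : d + 1 ≤ i + k) :
    q (Fin.last (d + 1)) ≤ (rowStep 0)^[k] q i := by
  induction k generalizing i with
  | zero =>
    have : i = Fin.last (d + 1) := Fin.ext (by simp; lia)
    rw [this]
    exact le_rfl
  | succ k ih =>
    induction i using Fin.lastCases with
    | last => exact le_iterate_rowStep_last _ hq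
    | cast i =>
      rw [Function.iterate_succ_apply']
      refine (ih i.succ ?_).trans
        (succ_le_rowStep_castSucc 0 (iterate_rowStep_nonneg 0 k hq) i)
      simp at hi ⊢
      lia

/-- The length of a block of zero digits whose product of branches is a positive matrix. -/
def blockLength (d : ℕ) : ℕ := 2 * d + 3

theorem le_iterate_rowStep_blockLength (hq : 0 ≤ q) (i j : Fin (d + 2)) :
    q i ≤ (rowStep 0)^[blockLength d] q j := by
  -- The first `i + 1` steps feed entry `i` into the last one, which does not decrease during the `d
  -- + 1 - i` idle steps; the final `d + 1` steps spread it to every place.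
  have : blockLength d = (d + 1) + ((d + 1 - i) + (i + 1)) := by unfold blockLength; lia
  rw [this, Function.iterate_add_apply _ (d + 1), Function.iterate_add_apply _ (d + 1 - i)]
  have h1 := iterate_rowStep_nonneg 0 (i + 1) hq
  exact ((le_iterate_rowStep_succ_last i i.2 hq).trans (le_iterate_rowStep_last _ h1)).trans
    (last_le_iterate_rowStep (d + 1) (iterate_rowStep_nonneg 0 _ h1) j (by lia))

theorem sum_le_iterate_rowStep_blockLength (hq : 0 ≤ q) (j : Fin (d + 2)) :
    ∑ i, q i ≤ (d + 2) * (rowStep 0)^[blockLength d] q j := by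
  have := Finset.sum_le_card_nsmul Finset.univ q _
    (fun i _ => le_iterate_rowStep_blockLength hq i j)
  simpa using this

theorem rowStep_zero_le {c : ℝ} (hc : 0 ≤ c) (h : ∀ i, q i ≤ c) (i : Fin (d + 2)) :
    rowStep 0 q i ≤ 2 * c := by
  induction i using Fin.lastCases with
  | last => have := h 0; have := h (Fin.last (d + 1)); simp; linarith
  | cast i =>
    induction i using Fin.lastCases with
    | last => have := h (Fin.last (d + 1)); simp; linarith
    | cast i => have := h i.castSucc.succ; rw [rowStep_castSucc_castSucc]; linarith

theorem iterate_rowStep_le_sum (hq : 0 ≤ q) (k : ℕ) (j : Fin (d + 2)) :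
    (rowStep 0)^[k] q j ≤ 2 ^ k * ∑ i, q i := by
  have hs : 0 ≤ ∑ i, q i := Finset.sum_nonneg fun i _ => hq i
  induction k generalizing j with
  | zero => simpa using Finset.single_le_sum (fun i _ => hq i) (Finset.mem_univ j)
  | succ k ih =>
    rw [Function.iterate_succ_apply', pow_succ', mul_assoc]
    exact rowStep_zero_le (by positivity) ih j

/-- The contraction rate of a block of zero digits. -/
noncomputable def contraction (d : ℕ) : ℝ := 1 - (((d : ℝ) + 2) * 2 ^ blockLength d)⁻¹

theorem contraction_lt_one (d : ℕ) : contraction d < 1 := by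
  unfold contraction
  have : (0 : ℝ) < (((d : ℝ) + 2) * 2 ^ blockLength d)⁻¹ := by positivity
  linarith

theorem iterate_rowStep_sub_smul (b k : ℕ) (a : Fin (d + 2) → ℝ) (c : ℝ) :
    (rowStep b)^[k] (a - c • q) = (rowStep b)^[k] a - c • (rowStep b)^[k] q := by
  induction k with
  | zero => rfl
  | succ k ih => simp only [Function.iterate_succ_apply', ih, rowStep_sub, rowStep_smul]

/-- The nonnegative row `a - m • q` has sum `t * ∑ i, q i`. After the block each of its entries is
at least `1 / (d + 2)` of that sum, while the entries coming from `q` are at most `2 ^ blockLength d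
* ∑ i, q i`; the quotient is the gain in the lower constant. -/
theorem smul_le_iterate_zero_block {a : Fin (d + 2) → ℝ} (hq : 0 ≤ q) {m t : ℝ}
    (ht : 0 ≤ t) (h : m • q ≤ a) (hs : t * ∑ i, q i = ∑ i, a i - m * ∑ i, q i) :
    (m + (((d : ℝ) + 2) * 2 ^ blockLength d)⁻¹ * t) • (rowStep 0)^[blockLength d] q
      ≤ (rowStep 0)^[blockLength d] a := by
  intro j
  have h1 := sum_le_iterate_rowStep_blockLength (sub_nonneg.2 h) j
  rw [iterate_rowStep_sub_smul] at h1
  have h2 := iterate_rowStep_le_sum hq (blockLength d) j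
  simp only [Pi.sub_apply, Pi.smul_apply, smul_eq_mul, Finset.sum_sub_distrib,
    ← Finset.mul_sum, ← hs] at h1 ⊢
  have h3 := (mul_le_mul_of_nonneg_left h2 ht)
  set A := (rowStep 0)^[blockLength d] a j
  set B := (rowStep 0)^[blockLength d] q j
  set P : ℝ := 2 ^ blockLength d
  have hP : 0 < P := by positivity
  have hd : (0 : ℝ) < d + 2 := by positivity
  rw [add_mul, ← le_sub_iff_add_le', mul_assoc, inv_mul_le_iff₀ (by positivity)]
  have h4 := mul_le_mul_of_nonneg_left h1 hP.le
  linarith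

/-- A block of zero digits brings two comparable rows closer by a definite factor. -/
theorem exists_pinch_zero_block {a : Fin (d + 2) → ℝ} (hq : 0 ≤ q) (hq' : 0 < ∑ i, q i)
    {m M : ℝ} (h1 : m • q ≤ a) (h2 : a ≤ M • q) :
    ∃ m' M', m' • (rowStep 0)^[blockLength d] q ≤ (rowStep 0)^[blockLength d] a ∧
      (rowStep 0)^[blockLength d] a ≤ M' • (rowStep 0)^[blockLength d] q ∧
      M' - m' = contraction d * (M - m) := by
  -- The ratio of sums lies between `m` and `M`. The lower constant gains in proportion to `s - m`
  -- and the upper one in proportion to `M - s`, so `s` cancels from the new width.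
  set s := (∑ i, a i) / ∑ i, q i
  have hs : s * ∑ i, q i = ∑ i, a i := div_mul_cancel₀ _ hq'.ne'
  have hm : m ≤ s := by
    rw [le_div_iff₀ hq', Finset.mul_sum]
    exact Finset.sum_le_sum fun i _ => h1 i
  have hM : s ≤ M := by
    rw [div_le_iff₀ hq', Finset.mul_sum]
    exact Finset.sum_le_sum fun i _ => h2 i
  have h3 := smul_le_iterate_zero_block hq (sub_nonneg.2 hm) h1 (by rw [sub_mul, hs])
  have hneg : ∀ r : Fin (d + 2) → ℝ, (rowStep 0)^[blockLength d] (-r)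
      = -(rowStep 0)^[blockLength d] r := by
    intro r
    have e := iterate_rowStep_sub_smul (q := r) 0 (blockLength d) r 2
    have : r - (2 : ℝ) • r = -r := by module
    rw [this] at e
    rw [e]
    module
  have h4 := smul_le_iterate_zero_block (a := -a) (m := -M) hq (sub_nonneg.2 hM)
    (by simpa using h2) (by simp only [Pi.neg_apply, Finset.sum_neg_distrib, ← hs]; ring)
  rw [hneg, le_neg, ← neg_smul] at h4
  refine ⟨_, _, h3, h4, ?_⟩
  unfold contraction
  ring

end ZeroBlock

/-! ### Weak convergence from recurring zero blocks -/

/-- The row `q` multiplied by the branches with digits `b 0, …, b (m - 1)`. -/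
def rows {d : ℕ} (b : ℕ → ℕ) (q : Fin (d + 2) → ℝ) : ℕ → Fin (d + 2) → ℝ
  | 0 => q
  | m + 1 => rowStep (b m) (rows b q m)

section Rows

variable {d : ℕ} {b : ℕ → ℕ} {q a : Fin (d + 2) → ℝ}

theorem rows_nonneg (hq : 0 ≤ q) (m : ℕ) : 0 ≤ rows b q m := by
  induction m with
  | zero => exact hq
  | succ m ih => exact rowStep_nonneg _ ih

theorem rows_pos (hq : ∀ i, 0 < q i) (m : ℕ) : ∀ i, 0 < rows b q m i := by
  induction m with
  | zero => exact hq
  | succ m ih => exact rowStep_pos _ ih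

theorem rows_add_of_zero {m k : ℕ} (h : ∀ i < k, b (m + i) = 0) :
    rows b q (m + k) = (rowStep 0)^[k] (rows b q m) := by
  induction k with
  | zero => rfl
  | succ k ih =>
    rw [Function.iterate_succ_apply', ← ih fun i hi => h i (by lia), ← add_assoc, rows,
      h k (by lia)]

/-- `rowStep` is linear and preserves nonnegativity, so both inequalities persist with the same
constants. -/
theorem rows_pinch_mono {m M : ℝ} {N N' : ℕ} (hN : N ≤ N')
    (h1 : m • rows b q N ≤ rows b a N) (h2 : rows b a N ≤ M • rows b q N) :
    m • rows b q N' ≤ rows b a N' ∧ rows b a N' ≤ M • rows b q N' := by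
  induction N', hN using Nat.le_induction with
  | base => exact ⟨h1, h2⟩
  | succ k _ ih =>
    simp only [rows]
    constructor
    · rw [← sub_nonneg, ← rowStep_smul, ← rowStep_sub]
      exact rowStep_nonneg _ (sub_nonneg.2 ih.1)
    · rw [← sub_nonneg, ← rowStep_smul, ← rowStep_sub]
      exact rowStep_nonneg _ (sub_nonneg.2 ih.2)

/-- Infinitely many blocks of zero digits make two comparable rows asymptotically
proportional. -/
theorem exists_rows_pinch (hb : ∀ k, ∃ j ≥ k, ∀ i < blockLength d, b (j + i) = 0)
    (hq : ∀ i, 0 < q i) (ha : 0 ≤ a) (haq : a ≤ q) (r : ℕ) :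
    ∃ N m M, m • rows b q N ≤ rows b a N ∧ rows b a N ≤ M • rows b q N ∧
      M - m = contraction d ^ r := by
  induction r with
  | zero => exact ⟨0, 0, 1, by simpa [rows] using ha, by simpa [rows] using haq, by simp⟩
  | succ r ih =>
    obtain ⟨N, m, M, h1, h2, h3⟩ := ih
    obtain ⟨j, hj, hz⟩ := hb N
    obtain ⟨h4, h5⟩ := rows_pinch_mono hj h1 h2
    have hp := rows_pos (b := b) hq j
    obtain ⟨m', M', h6, h7, h8⟩ := exists_pinch_zero_block (rows_nonneg (fun i => (hq i).le) j)
      (Finset.sum_pos (fun i _ => hp i) Finset.univ_nonempty) h4 h5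
    refine ⟨j + blockLength d, m', M', ?_, ?_, ?_⟩
    · rwa [rows_add_of_zero hz, rows_add_of_zero hz]
    · rwa [rows_add_of_zero hz, rows_add_of_zero hz]
    · rw [h8, h3, pow_succ']

end Rows

section Cylinder

variable {d : ℕ} {b : ℕ → ℕ} {x y : Fin (d + 1) → ℝ}

theorem dotProduct_gaps (q : Fin (d + 2) → ℝ) (x : Fin (d + 1) → ℝ) :
    q ⬝ᵥ gaps x = q 0 + ∑ i, (q i.succ - q i.castSucc) * x i := by
  simp only [dotProduct, gaps, mul_sub, Finset.sum_sub_distrib, sub_mul]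
  rw [Fin.sum_univ_succ, Fin.sum_univ_castSucc (n := d + 1)]
  simp only [Fin.cons_zero, Fin.cons_succ, Fin.snoc_castSucc, Fin.snoc_last]
  ring

theorem one_dotProduct_gaps (x : Fin (d + 1) → ℝ) : 1 ⬝ᵥ gaps x = 1 := by
  simp [dotProduct_gaps]

/-- The row that reads off the coordinate `x j` from the differences of `x`. -/
def tailRow (d : ℕ) (j : Fin (d + 1)) : Fin (d + 2) → ℝ := fun i => if j.succ ≤ i then 1 else 0

theorem tailRow_dotProduct_gaps (j : Fin (d + 1)) (x : Fin (d + 1) → ℝ) :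
    tailRow d j ⬝ᵥ gaps x = x j := by
  rw [dotProduct_gaps, Finset.sum_eq_single j]
  · simp [tailRow]
  · intro i _ hij
    have : j.succ ≤ i.castSucc ↔ j.succ ≤ i.succ := by
      simp only [Fin.le_def, Fin.val_succ, Fin.val_castSucc]
      have := Fin.val_ne_of_ne hij
      lia
    simp [tailRow, this]
  · simp

/-- The scalar `c` does not depend on the row `q`, so it cancels from quotients of two functionals.
-/
theorem gaps_iterate (hy : y ∈ simplex d) (m : ℕ)
    (h : ∀ k < m, (triangleMap d)^[k] y ∈ subsimplex d (b k)) :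
    (triangleMap d)^[m] y ∈ simplex d ∧
      ∃ c > 0, ∀ q, q ⬝ᵥ gaps y = c * (rows b q m ⬝ᵥ gaps ((triangleMap d)^[m] y)) := by
  induction m with
  | zero => exact ⟨hy, 1, one_pos, fun q => by simp [rows]⟩
  | succ m ih =>
    obtain ⟨-, c, hc, h2⟩ := ih fun k hk => h k (by lia)
    have hm := h m (by lia)
    rw [Function.iterate_succ_apply']
    refine ⟨triangleMap_mem_simplex hm, _, mul_pos hc (zero_pos_of_mem_subsimplex hm), ?_⟩
    intro q
    rw [h2, gaps_eq_smul_branch hm, dotProduct_smul, dotProduct_branch, smul_eq_mul, mul_assoc]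
    rfl

/-- The row `1` takes the value `1` on differences, so `y j` is the quotient of the two evolved rows
at one nonnegative vector and inherits their bounds. -/
theorem mem_Icc_of_rows_pinch {N : ℕ} {m M : ℝ} {j : Fin (d + 1)}
    (h1 : m • rows b 1 N ≤ rows b (tailRow d j) N)
    (h2 : rows b (tailRow d j) N ≤ M • rows b 1 N) (hy : y ∈ cylinder d b N) :
    y j ∈ Icc m M := by
  obtain ⟨h3, c, hc, h4⟩ := gaps_iterate (b := b) (y := y) (hy 0 (Nat.zero_le _)).1 N
    fun k hk => hy k hk.le
  have h5 := gaps_nonneg h3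
  have e1 := h4 1
  have e2 := h4 (tailRow d j)
  rw [one_dotProduct_gaps] at e1
  rw [tailRow_dotProduct_gaps] at e2
  have k1 := mul_le_mul_of_nonneg_left (dotProduct_le_dotProduct_of_nonneg_right h1 h5) hc.le
  have k2 := mul_le_mul_of_nonneg_left (dotProduct_le_dotProduct_of_nonneg_right h2 h5) hc.le
  rw [smul_dotProduct, smul_eq_mul, mul_left_comm, ← e1, ← e2] at k1
  rw [smul_dotProduct, smul_eq_mul, mul_left_comm, ← e1, ← e2] at k2
  constructor <;> linarith

/-- Infinitely many long blocks of zero digits force weak convergence. -/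
theorem weaklyConvergesAt_of_zero_blocks (hx : IsTriangleSequence d x b)
    (hb : ∀ k, ∃ j ≥ k, ∀ i < blockLength d, b (j + i) = 0) : WeaklyConvergesAt d x := by
  have hmem : ∀ N, x ∈ cylinder d b N := fun N k _ => hx k
  have hU : ∀ U ∈ 𝓝 x, ∀ᶠ m : ℕ in atTop, cylinder d b m ⊆ U := by
    intro U hU
    obtain ⟨ε, hε, hball⟩ := Metric.mem_nhds_iff.1 hU
    obtain ⟨r, hr⟩ := exists_pow_lt_of_lt_one hε (contraction_lt_one d)
    have key : ∀ j : Fin (d + 1), ∀ᶠ N in atTop, ∀ y ∈ cylinder d b N, dist (y j) (x j) < ε := by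
      intro j
      obtain ⟨N, m, M, h1, h2, h3⟩ := exists_rows_pinch (q := 1) (a := tailRow d j) hb
        (fun _ => one_pos) (fun i => by simp only [tailRow, Pi.zero_apply]; split_ifs <;> simp)
        (fun i => by simp only [tailRow, Pi.one_apply]; split_ifs <;> simp) r
      filter_upwards [eventually_ge_atTop N] with N' hN y hy
      obtain ⟨h4, h5⟩ := rows_pinch_mono hN h1 h2
      have hy' := mem_Icc_of_rows_pinch h4 h5 hy
      have hx' := mem_Icc_of_rows_pinch h4 h5 (hmem N')
      exact (Real.dist_le_of_mem_Icc hy' hx').trans_lt (h3 ▸ hr)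
    filter_upwards [eventually_all.2 key] with N hN y hy
    exact hball ((dist_pi_lt_iff hε).2 fun j => hN j y hy)
  refine ⟨b, hx, ?_, hU⟩
  refine Subset.antisymm (fun y hy => ?_) (by simpa using hmem)
  by_contra hne
  obtain ⟨N, hN⟩ := (hU {y}ᶜ (isOpen_compl_singleton.mem_nhds (Ne.symm hne))).exists
  exact hN (mem_iInter.1 hy N) rfl

end Cylinder

/-! ### Volumes of cones and the weight of a row -/

/-- The open cone over the vectors of differences of the points of `X`. -/
def cone {d : ℕ} (X : Set (Fin (d + 1) → ℝ)) : Set (Fin (d + 2) → ℝ) :=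
  {u | ∃ c : ℝ, 0 < c ∧ ∃ x ∈ X, u = c • gaps x}

/-- The volume of the part of the cone over `X` on which the row `q` is less than `1`. -/
noncomputable def coneVol {d : ℕ} (X : Set (Fin (d + 1) → ℝ)) (q : Fin (d + 2) → ℝ) : ENNReal :=
  volume (cone X ∩ {u | q ⬝ᵥ u < 1})

/-- The points of the simplex with positive last coordinate, where a digit is defined. -/
def digitDomain (d : ℕ) : Set (Fin (d + 1) → ℝ) := {x | x ∈ simplex d ∧ 0 < x (Fin.last d)}

section ConeVol

variable {d : ℕ} {X Y : Set (Fin (d + 1) → ℝ)} {q : Fin (d + 2) → ℝ}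

theorem cone_mono (h : X ⊆ Y) : cone X ⊆ cone Y := by
  rintro u ⟨c, hc, x, hx, rfl⟩
  exact ⟨c, hc, x, h hx, rfl⟩

theorem coneVol_mono (h : X ⊆ Y) (q : Fin (d + 2) → ℝ) : coneVol X q ≤ coneVol Y q :=
  measure_mono (inter_subset_inter_left _ (cone_mono h))

theorem cone_subset_iUnion (hX : X ⊆ digitDomain d) :
    cone X ⊆ ⋃ b : ℕ, branch b '' cone (triangleMap d '' (X ∩ subsimplex d b)) := by
  rintro u ⟨c, hc, x, hx, rfl⟩
  have hs := mem_subsimplex_digit (hX hx).1 (hX hx).2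
  have h0 := zero_pos_of_mem_subsimplex hs
  refine mem_iUnion.2 ⟨digit d x, (c * x 0) • gaps (triangleMap d x),
    ⟨_, mul_pos hc h0, _, mem_image_of_mem _ ⟨hx, hs⟩, rfl⟩, ?_⟩
  rw [gaps_eq_smul_branch hs, ← branchLin_apply, ← branchLin_apply, map_smul, mul_smul]

/-- Branches preserve volume, and countable subadditivity suffices, so `X` need not be measurable.
-/
theorem coneVol_le_tsum (hX : X ⊆ digitDomain d) (q : Fin (d + 2) → ℝ) :
    coneVol X q ≤ ∑' b : ℕ, coneVol (triangleMap d '' (X ∩ subsimplex d b)) (rowStep b q) := by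
  have : cone X ∩ {u | q ⬝ᵥ u < 1} ⊆ ⋃ b : ℕ, branch b ''
      (cone (triangleMap d '' (X ∩ subsimplex d b)) ∩ {u | rowStep b q ⬝ᵥ u < 1}) := by
    rintro u ⟨hu, hq⟩
    obtain ⟨b, v, hv, rfl⟩ := mem_iUnion.1 (cone_subset_iUnion hX hu)
    refine mem_iUnion.2 ⟨b, v, ⟨hv, ?_⟩, rfl⟩
    rwa [mem_ofPred_eq, dotProduct_branch] at hq
  refine (measure_mono this).trans ((measure_iUnion_le _).trans (ENNReal.tsum_le_tsum fun b => ?_))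
  rw [volume_image_branch]
  exact le_rfl

theorem volume_cone_eq_zero_of_image (hX : X ⊆ digitDomain d) (hT : MapsTo (triangleMap d) X Y)
    (hY : volume (cone Y) = 0) : volume (cone X) = 0 := by
  refine measure_mono_null (cone_subset_iUnion hX) (measure_iUnion_null fun b => ?_)
  rw [volume_image_branch]
  exact measure_mono_null (cone_mono (hT.mono_left inter_subset_left).image_subset) hY

/-- The reciprocal of the product of the entries of a row. -/
noncomputable def weight (q : Fin (d + 2) → ℝ) : ℝ := ∏ i, (q i)⁻¹

theorem weight_pos (hq : ∀ i, 0 < q i) : 0 < weight q :=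
  Finset.prod_pos fun i _ => inv_pos.2 (hq i)

/-- In the positive orthant `q ⬝ᵥ u < 1` forces `u` into a box. The factor `1 / (d + 2)!` of the
simplex is given up, since only a finite initial constant is needed. -/
theorem coneVol_le_weight (hX : X ⊆ simplex d) (hq : ∀ i, 0 < q i) :
    coneVol X q ≤ ENNReal.ofReal (weight q) := by
  have : cone X ∩ {u | q ⬝ᵥ u < 1} ⊆ Icc 0 (fun i => (q i)⁻¹) := by
    rintro u ⟨⟨c, hc, x, hx, rfl⟩, hu⟩
    have hn : ∀ i, 0 ≤ (c • gaps x) i := fun i => mul_nonneg hc.le (gaps_nonneg (hX hx) i)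
    refine ⟨hn, fun i => ?_⟩
    have := Finset.single_le_sum (f := fun i => q i * (c • gaps x) i)
      (fun i _ => mul_nonneg (hq i).le (hn i)) (Finset.mem_univ i)
    have h1 : q i * (c • gaps x) i ≤ 1 := this.trans (le_of_lt hu)
    change (c • gaps x) i ≤ (q i)⁻¹
    rwa [← one_div, le_div_iff₀ (hq i), mul_comm]
  refine (measure_mono this).trans ?_
  rw [Real.volume_Icc_pi, weight, ENNReal.ofReal_prod_of_nonneg]
  · simp
  · exact fun i _ => (inv_pos.2 (hq i)).le

/-- Partial fractions: the sum over digits telescopes, and the quotient with `b * q 0` in its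
denominator is the share of the weight carried by digits at least `b`. -/
theorem weight_rowStep (b : ℕ) (hq : ∀ i, 0 < q i) :
    weight (rowStep b q) =
      weight q * (q (Fin.last (d + 1)) / (q (Fin.last (d + 1)) + b * q 0)) -
      weight q * (q (Fin.last (d + 1)) / (q (Fin.last (d + 1)) + (b + 1 : ℕ) * q 0)) := by
  unfold weight
  rw [Fin.prod_univ_castSucc, Fin.prod_univ_castSucc,
    Fin.prod_univ_succ (n := d + 1), Fin.prod_univ_castSucc (n := d)]
  simp only [rowStep_last, rowStep_last_castSucc, rowStep_castSucc_castSucc]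
  rw [Fin.succ_last]
  have h0 := hq 0
  have h1 := hq (Fin.last (d + 1))
  have h2 : q (Fin.last (d + 1)) + b * q 0 ≠ 0 := by positivity
  have h3 : q (Fin.last (d + 1)) + (b + 1) * q 0 ≠ 0 := by positivity
  push_cast
  field_simp
  ring

theorem tendsto_div_add_nat_mul {s t : ℝ} (ht : 0 < t) :
    Tendsto (fun b : ℕ => s / (s + b * t)) atTop (𝓝 0) :=
  (tendsto_atTop_add_const_left _ s
    (tendsto_natCast_atTop_atTop.atTop_mul_const ht)).const_div_atTop s

theorem hasSum_weight_rowStep (hq : ∀ i, 0 < q i) :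
    HasSum (fun b => weight (rowStep b q)) (weight q) := by
  rw [hasSum_iff_tendsto_nat_of_nonneg fun b => (weight_pos (rowStep_pos b hq)).le]
  simp only [weight_rowStep _ hq]
  simp only [Finset.sum_range_sub' (fun b : ℕ => weight q *
    (q (Fin.last (d + 1)) / (q (Fin.last (d + 1)) + b * q 0)))]
  have := ((tendsto_div_add_nat_mul (s := q (Fin.last (d + 1))) (hq 0)).const_mul
    (weight q)).const_sub (weight q)
  simpa [(hq _).ne'] using this

/-- If the branches with digits below `B` contribute with a smaller constant `η`, the total
constant drops below `H` by a definite amount. -/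
theorem tsum_le_of_le_weight_rowStep (hq : ∀ i, 0 < q i) {c : ℕ → ENNReal} {η H δ : ℝ} {B : ℕ}
    (hη : 0 ≤ η) (hH : η ≤ H)
    (h1 : ∀ b < B, c b ≤ ENNReal.ofReal (η * weight (rowStep b q)))
    (h2 : ∀ b, c b ≤ ENNReal.ofReal (H * weight (rowStep b q)))
    (hδ : q (Fin.last (d + 1)) / (q (Fin.last (d + 1)) + B * q 0) ≤ 1 - δ) :
    ∑' b, c b ≤ ENNReal.ofReal ((H - δ * (H - η)) * weight q) := by
  have hw : ∀ b, 0 ≤ weight (rowStep b q) := fun b => (weight_pos (rowStep_pos b hq)).le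
  -- The constant `H` everywhere, less a saving of `H - η` on the digits below `B`, which carry at
  -- least the share `δ` of the weight.
  let f : ℕ → ℝ := fun b => H * weight (rowStep b q) -
    if b ∈ Finset.range B then (H - η) * weight (rowStep b q) else 0
  have hf0 : ∀ b, 0 ≤ f b := by
    intro b
    have := mul_nonneg hη (hw b)
    have := mul_nonneg (hη.trans hH) (hw b)
    simp only [f]
    split_ifs <;> linarith
  have hcf : ∀ b, c b ≤ ENNReal.ofReal (f b) := by
    intro b
    by_cases hb : b < B
    · have : f b = η * weight (rowStep b q) := by simp [f, hb]; ring
      exact this ▸ h1 b hb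
    · have : f b = H * weight (rowStep b q) := by simp [f, hb]
      exact this ▸ h2 b
  have hfin : HasSum (fun b => if b ∈ Finset.range B then (H - η) * weight (rowStep b q) else 0)
      (∑ b ∈ Finset.range B, (H - η) * weight (rowStep b q)) := by
    rw [← Finset.sum_congr rfl fun b hb => if_pos hb]
    exact hasSum_sum_of_ne_finset_zero fun b hb => if_neg hb
  have hsum := ((hasSum_weight_rowStep hq).mul_left H).sub hfin
  refine (ENNReal.tsum_le_tsum hcf).trans ?_
  rw [← ENNReal.ofReal_tsum_of_nonneg hf0 hsum.summable, hsum.tsum_eq]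
  apply ENNReal.ofReal_le_ofReal
  rw [← Finset.mul_sum]
  simp only [weight_rowStep _ hq]
  rw [Finset.sum_range_sub' (fun b : ℕ => weight q *
    (q (Fin.last (d + 1)) / (q (Fin.last (d + 1)) + b * q 0)))]
  have h3 : q (Fin.last (d + 1)) / (q (Fin.last (d + 1)) + (0 : ℕ) * q 0) = 1 := by
    simp [(hq _).ne']
  rw [h3]
  have h4 := mul_le_mul_of_nonneg_left hδ (mul_nonneg (sub_nonneg.2 hH) (weight_pos hq).le)
  linarith

end ConeVol

/-! ### Points without a zero block form a null set -/

/-- The points with all digits defined but without any block of `blockLength d` zero digits. -/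
def noZeroBlock (d : ℕ) : Set (Fin (d + 1) → ℝ) :=
  {x | ∀ k, (triangleMap d)^[k] x ∈ digitDomain d ∧
    ¬ ∀ i < blockLength d, digit d ((triangleMap d)^[i] ((triangleMap d)^[k] x)) = 0}

/-- The points of `noZeroBlock d` whose first `j` digits are not all zero. -/
def noZeroPrefix (d j : ℕ) : Set (Fin (d + 1) → ℝ) :=
  {x | x ∈ noZeroBlock d ∧ ¬ ∀ i < j, digit d ((triangleMap d)^[i] x) = 0}

/-- The volumes of the cones over `noZeroBlock d` are at most `H` times the weight. -/
def VolBound (d : ℕ) (H : ℝ) : Prop :=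
  ∀ q : Fin (d + 2) → ℝ, (∀ i, 0 < q i) → Monotone q →
    coneVol (noZeroBlock d) q ≤ ENNReal.ofReal (H * weight q)

section NoZeroBlock

variable {d : ℕ}

theorem noZeroBlock_subset : noZeroBlock d ⊆ digitDomain d := fun _ hx => (hx 0).1

theorem mapsTo_noZeroBlock : MapsTo (triangleMap d) (noZeroBlock d) (noZeroBlock d) := by
  intro x hx k
  have := hx (k + 1)
  rwa [Function.iterate_succ_apply] at this

theorem noZeroPrefix_subset (j : ℕ) : noZeroPrefix d j ⊆ noZeroBlock d := fun _ hx => hx.1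

theorem noZeroPrefix_blockLength : noZeroPrefix d (blockLength d) = noZeroBlock d :=
  Subset.antisymm (noZeroPrefix_subset _) fun _ hx => ⟨hx, (hx 0).2⟩

theorem triangleMap_image_noZeroPrefix_subset (j : ℕ) :
    triangleMap d '' (noZeroPrefix d (j + 1) ∩ subsimplex d 0) ⊆ noZeroPrefix d j := by
  rintro _ ⟨x, ⟨hx, hx0⟩, rfl⟩
  refine ⟨mapsTo_noZeroBlock hx.1, fun h => hx.2 fun i hi => ?_⟩
  cases i with
  | zero => exact digit_eq_of_mem_subsimplex hx0
  | succ i => rw [Function.iterate_succ_apply]; exact h i (by lia)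

/-- Digit zero carries a share at least `1 / (K + 1)` of the weight, and its successor row satisfies
the hypothesis with `K + 1`. After `j` rounds a positive share remains on which the first `j` digits
vanish, and this share misses the set. -/
theorem exists_coneVol_noZeroPrefix_le (j : ℕ) {K : ℝ} (hK : 0 < K) :
    ∃ ε : ℝ, 0 < ε ∧ ε ≤ 1 ∧ ∀ H, 0 ≤ H → VolBound d H → ∀ q : Fin (d + 2) → ℝ,
      (∀ i, 0 < q i) → Monotone q → q (Fin.last (d + 1)) ≤ K * q 0 →
      coneVol (noZeroPrefix d j) q ≤ ENNReal.ofReal ((1 - ε) * H * weight q) := by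
  induction j generalizing K with
  | zero =>
    refine ⟨1, one_pos, le_rfl, fun H _ _ q _ _ _ => ?_⟩
    have : noZeroPrefix d 0 = ∅ := by ext x; simp [noZeroPrefix]
    simp [this, coneVol, cone]
  | succ j ih =>
    obtain ⟨ε, hε, hε1, h⟩ := ih (K := K + 1) (by linarith)
    have hδ0 : 0 < (K + 1)⁻¹ := by positivity
    have hδ1 : (K + 1)⁻¹ ≤ 1 := inv_le_one_of_one_le₀ (by linarith)
    refine ⟨(K + 1)⁻¹ * ε, by positivity, mul_le_one₀ hδ1 hε.le hε1,
      fun H hH hb q hq hm hqK => ?_⟩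
    have h0 := hq 0
    have h1 := hq (Fin.last (d + 1))
    refine (coneVol_le_tsum ((noZeroPrefix_subset _).trans noZeroBlock_subset) q).trans ?_
    have e : (1 - (K + 1)⁻¹ * ε) * H = H - (K + 1)⁻¹ * (H - (1 - ε) * H) := by ring
    rw [e]
    refine tsum_le_of_le_weight_rowStep hq (B := 1) (mul_nonneg (by linarith) hH)
      (by nlinarith) ?_ ?_ ?_
    · intro b hb'
      obtain rfl : b = 0 := by lia
      refine (coneVol_mono (triangleMap_image_noZeroPrefix_subset j) _).trans
        (h H hH hb _ (rowStep_pos 0 hq) (rowStep_monotone 0 h0.le hm) ?_)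
      have h2 : q 0 ≤ rowStep 0 q 0 :=
        (hm (Fin.zero_le _)).trans
          (succ_le_rowStep_castSucc 0 (fun i => (hq i).le) (0 : Fin (d + 1)))
      rw [rowStep_last]
      push_cast
      nlinarith
    · intro b
      refine (coneVol_mono ?_ _).trans
        (hb _ (rowStep_pos b hq) (rowStep_monotone b h0.le hm))
      exact (mapsTo_noZeroBlock.mono_left
        (inter_subset_left.trans (noZeroPrefix_subset _))).image_subset
    · rw [div_le_iff₀ (by positivity)]
      have : (K + 1)⁻¹ * (q (Fin.last (d + 1)) + q 0) ≤ q 0 := by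
        rw [inv_mul_le_iff₀ (by positivity)]
        linarith
      push_cast
      linarith

/-- Digits below `⌈q_last / q 0⌉` carry at least half of the weight. Each of them at most triples
the last entry, while entry `i + 1` moves to place `i` without decreasing. Comparability with the
last entry thus travels left to place `0`, where the prefix estimate applies. -/
theorem exists_coneVol_noZeroBlock_le (i : ℕ) (hi : i < d + 2) {K : ℝ} (hK : 0 < K) :
    ∃ ε : ℝ, 0 < ε ∧ ε ≤ 1 ∧ ∀ H, 0 ≤ H → VolBound d H → ∀ q : Fin (d + 2) → ℝ,
      (∀ i, 0 < q i) → Monotone q → q (Fin.last (d + 1)) ≤ K * q ⟨i, hi⟩ →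
      coneVol (noZeroBlock d) q ≤ ENNReal.ofReal ((1 - ε) * H * weight q) := by
  induction i generalizing K with
  | zero =>
    have := exists_coneVol_noZeroPrefix_le (d := d) (blockLength d) hK
    rwa [noZeroPrefix_blockLength] at this
  | succ i ih =>
    obtain ⟨ε, hε, hε1, h⟩ := ih (by lia) (K := 3 * K) (by linarith)
    refine ⟨2⁻¹ * ε, by positivity, by linarith, fun H hH hb q hq hm hqK => ?_⟩
    have h0 := hq 0
    have h1 := hq (Fin.last (d + 1))
    refine (coneVol_le_tsum noZeroBlock_subset q).trans ?_
    have e : (1 - 2⁻¹ * ε) * H = H - 2⁻¹ * (H - (1 - ε) * H) := by ring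
    rw [e]
    have hB1 := Nat.le_ceil (q (Fin.last (d + 1)) / q 0)
    have hB2 := Nat.ceil_lt_add_one (div_pos h1 h0).le
    set B := ⌈q (Fin.last (d + 1)) / q 0⌉₊
    rw [div_le_iff₀ h0] at hB1
    rw [← sub_lt_iff_lt_add, lt_div_iff₀ h0] at hB2
    have hle := hm (Fin.zero_le (Fin.last (d + 1)))
    have hgen : ∀ b, coneVol (triangleMap d '' (noZeroBlock d ∩ subsimplex d b)) (rowStep b q)
        ≤ coneVol (noZeroBlock d) (rowStep b q) := fun b =>
      coneVol_mono (mapsTo_noZeroBlock.mono_left inter_subset_left).image_subset _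
    refine tsum_le_of_le_weight_rowStep hq (B := B) (mul_nonneg (by linarith) hH)
      (by nlinarith) ?_ ?_ ?_
    · intro b hbB
      refine (hgen b).trans
        (h H hH hb _ (rowStep_pos b hq) (rowStep_monotone b h0.le hm) ?_)
      have h2 := succ_le_rowStep_castSucc b (fun i => (hq i).le) ⟨i, by lia⟩
      have h3 : q ⟨i + 1, hi⟩ ≤ rowStep b q ⟨i, by lia⟩ := h2
      have h4 : (b : ℝ) + 1 ≤ B := by exact_mod_cast hbB
      rw [rowStep_last]
      -- Here `(b + 1) * q 0 ≤ B * q 0 < q_last + q 0 ≤ 2 * q_last`, whence the factor `3`.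
      nlinarith
    · exact fun b => (hgen b).trans (hb _ (rowStep_pos b hq) (rowStep_monotone b h0.le hm))
    · rw [div_le_iff₀ (by positivity)]
      linarith

theorem coneVol_noZeroBlock (q : Fin (d + 2) → ℝ) (hq : ∀ i, 0 < q i) (hm : Monotone q) :
    coneVol (noZeroBlock d) q = 0 := by
  -- Place `d + 1` is the last one, so with `K = 1` the comparison is trivial and one `ε` serves all
  -- increasing rows.
  obtain ⟨ε, hε, hε1, h⟩ := exists_coneVol_noZeroBlock_le (d := d) (d + 1) (by lia) one_pos
  have key : ∀ r : ℕ, VolBound d ((1 - ε) ^ r) := by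
    intro r
    induction r with
    | zero =>
      intro q hq _
      simpa using coneVol_le_weight (noZeroBlock_subset.trans fun x hx => hx.1) hq
    | succ r ih =>
      intro q hq hm
      rw [pow_succ']
      exact h _ (pow_nonneg (by linarith) r) ih q hq hm (by rw [one_mul]; exact le_rfl)
  have hlim : Tendsto (fun r : ℕ => ENNReal.ofReal ((1 - ε) ^ r * weight q)) atTop (𝓝 0) := by
    have := (tendsto_pow_atTop_nhds_zero_of_lt_one (r := 1 - ε) (by linarith)
      (by linarith)).mul_const (weight q)
    simpa using ENNReal.tendsto_ofReal this
  exact le_antisymm (ge_of_tendsto' hlim fun r => key r q hq hm) bot_le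

/-- Constant rows are increasing, and the regions of those with small entries exhaust the cone. -/
theorem volume_cone_noZeroBlock : volume (cone (noZeroBlock d)) = 0 := by
  have : cone (noZeroBlock d) ⊆ ⋃ m : ℕ, cone (noZeroBlock d) ∩
      {u | (fun _ => ((m : ℝ) + 1)⁻¹) ⬝ᵥ u < 1} := by
    intro u hu
    obtain ⟨m, hm⟩ := exists_nat_gt (∑ i, u i)
    refine mem_iUnion.2 ⟨m, hu, ?_⟩
    simp only [mem_ofPred_eq, dotProduct, ← Finset.mul_sum]
    rw [inv_mul_lt_iff₀ (by positivity)]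
    linarith
  exact measure_mono_null this (measure_iUnion_null fun m =>
    coneVol_noZeroBlock _ (fun _ => by positivity) monotone_const)

end NoZeroBlock

/-! ### From null cones to null sets, and pullbacks along the map -/

variable {d : ℕ}

/-- Successive differences of a vector, ending with its last coordinate. -/
def diffLin (d : ℕ) : (Fin (d + 2) → ℝ) →ₗ[ℝ] (Fin (d + 2) → ℝ) where
  toFun z i := z i - Fin.snoc (α := fun _ => ℝ) (fun j : Fin (d + 1) => z j.succ) 0 i
  map_add' z w := by
    ext i
    induction i using Fin.lastCases with
    | last => simp
    | cast i => simp only [Pi.add_apply, Fin.snoc_castSucc]; ring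
  map_smul' c z := by
    ext i
    induction i using Fin.lastCases with
    | last => simp
    | cast i => simp only [Pi.smul_apply, smul_eq_mul, Fin.snoc_castSucc, RingHom.id_apply]; ring

theorem det_diffLin_ne_zero (d : ℕ) : LinearMap.det (diffLin d) ≠ 0 := by
  refine (LinearMap.isUnit_det _ ((LinearMap.isUnit_iff_ker_eq_bot _).2
    (LinearMap.ker_eq_bot'.2 fun z hz => ?_))).ne_zero
  ext i
  induction i using Fin.reverseInduction with
  | last => simpa [diffLin] using congrFun hz (Fin.last (d + 1))
  | cast i ih =>
    have : z i.castSucc - z i.succ = 0 := by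
      simpa only [diffLin, LinearMap.coe_mk, AddHom.coe_mk, Fin.snoc_castSucc, Pi.zero_apply]
        using congrFun hz i.castSucc
    rw [ih] at this
    simpa using this

theorem diffLin_cons (x : Fin (d + 1) → ℝ) :
    diffLin d (Fin.cons (α := fun _ => ℝ) 1 x) = gaps x := by
  ext i
  simp [diffLin, gaps]

/-- A set over which the cone is null is itself null. -/
theorem volume_eq_zero_of_cone {X : Set (Fin (d + 1) → ℝ)} (h : volume (cone X) = 0) :
    volume X = 0 := by
  let e := MeasurableEquiv.piFinSuccAbove (fun _ : Fin (d + 2) => ℝ) 0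
  let E : Set (ℝ × (Fin (d + 1) → ℝ)) := {p | 0 < p.1 ∧ p.1⁻¹ • p.2 ∈ X}
  -- In homogeneous coordinates, `diffLin` sends `(t, w)` to `t • gaps (t⁻¹ • w)`.
  have hpre : diffLin d '' (e ⁻¹' E) ⊆ cone X := by
    rintro _ ⟨z, ⟨h0, hz⟩, rfl⟩
    refine ⟨z 0, h0, _, hz, ?_⟩
    rw [← diffLin_cons, ← map_smul]
    congr 1
    ext i
    have h0' : z 0 ≠ 0 := h0.ne'
    induction i using Fin.cases with
    | zero => simp
    | succ i =>
      rw [Pi.smul_apply, Fin.cons_succ]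
      change z i.succ = z 0 * ((z 0)⁻¹ * z i.succ)
      rw [mul_inv_cancel_left₀ h0']
  have h1 : volume (e ⁻¹' E) = 0 := by
    have := measure_mono_null hpre h
    rw [Measure.addHaar_image_linearMap, mul_eq_zero] at this
    refine this.resolve_left ?_
    simpa using det_diffLin_ne_zero d
  rw [(volume_preserving_piFinSuccAbove (fun _ : Fin (d + 2) => ℝ) 0).measure_preimage_equiv] at h1
  have h2 := Measure.measure_ae_null_of_prod_null h1
  -- By Fubini almost every slice is null, hence so is one at some height `t > 0`, and that slice is
  -- a dilate of `X`.
  obtain ⟨t, ht, ht0⟩ : ∃ t : ℝ, volume (Prod.mk t ⁻¹' E) = 0 ∧ 0 < t := by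
    by_contra! hcon
    have : volume (Ioi (0 : ℝ)) = 0 :=
      measure_mono_null (fun t ht => by
        intro hE
        exact absurd ht (not_lt.2 (hcon t hE))) h2
    simp at this
  have h3 : Prod.mk t ⁻¹' E = (fun w => t⁻¹ • w) ⁻¹' X := by
    ext w
    simp [E, ht0]
  rw [h3, Measure.addHaar_preimage_smul _ (inv_ne_zero ht0.ne'), mul_eq_zero] at ht
  refine ht.resolve_left ?_
  simp [ht0.ne']

/-- The points with a digit which the triangle map sends into `Y`. -/
def pullback (Y : Set (Fin (d + 1) → ℝ)) : Set (Fin (d + 1) → ℝ) :=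
  {x | x ∈ digitDomain d ∧ triangleMap d x ∈ Y}

theorem volume_cone_iterate_pullback {Y : Set (Fin (d + 1) → ℝ)} (hY : volume (cone Y) = 0)
    (k : ℕ) : volume (cone (pullback^[k] Y)) = 0 := by
  induction k with
  | zero => exact hY
  | succ k ih =>
    rw [Function.iterate_succ_apply']
    exact volume_cone_eq_zero_of_image (fun x hx => hx.1) (fun x hx => hx.2) ih

theorem mem_iterate_pullback {Y : Set (Fin (d + 1) → ℝ)} {x : Fin (d + 1) → ℝ} {k : ℕ}
    (h : ∀ i < k, (triangleMap d)^[i] x ∈ digitDomain d) (hk : (triangleMap d)^[k] x ∈ Y) :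
    x ∈ pullback^[k] Y := by
  induction k generalizing x with
  | zero => exact hk
  | succ k ih =>
    rw [Function.iterate_succ_apply']
    refine ⟨h 0 (by lia), ih (fun i hi => ?_) (by rwa [← Function.iterate_succ_apply])⟩
    rw [← Function.iterate_succ_apply]
    exact h _ (by lia)

theorem volume_cone_simplex_diff_digitDomain :
    volume (cone (simplex d \ digitDomain d)) = 0 := by
  refine measure_mono_null (t := {u | u (Fin.last (d + 1)) = 0}) ?_
    (Measure.pi_hyperplane _ (Fin.last (d + 1)) 0)
  rintro _ ⟨c, hc, x, ⟨hx, hx'⟩, rfl⟩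
  have : ¬ 0 < x (Fin.last d) := fun h => hx' ⟨hx, h⟩
  have : x (Fin.last d) = 0 := le_antisymm (not_lt.1 this) hx.2.2
  simp [this]

/-- Almost every point of the simplex has an infinite triangle sequence. -/
theorem ae_iterate_mem_digitDomain : ∀ᵐ x ∂(volume : Measure (Fin (d + 1) → ℝ)),
    x ∈ simplex d → ∀ k, (triangleMap d)^[k] x ∈ digitDomain d := by
  have := ae_all_iff.2 fun k => measure_eq_zero_iff_ae_notMem.1 (volume_eq_zero_of_cone
    (volume_cone_iterate_pullback (volume_cone_simplex_diff_digitDomain (d := d)) k))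
  filter_upwards [this] with x hx hs k
  induction k using Nat.strong_induction_on with
  | _ k ih =>
    by_contra hk
    refine hx k (mem_iterate_pullback ih ⟨?_, hk⟩)
    cases k with
    | zero => exact hs
    | succ k =>
      rw [Function.iterate_succ_apply']
      have := ih k (by lia)
      exact triangleMap_mem_simplex (mem_subsimplex_digit this.1 this.2)

end TriangleMap

theorem mainTheorem3 (d : ℕ) :
    ∀ᵐ x ∂(volume : Measure (Fin (d + 1) → ℝ)),
      x ∈ TriangleMap.simplex d → TriangleMap.WeaklyConvergesAt d x := by
  have := ae_all_iff.2 fun k => measure_eq_zero_iff_ae_notMem.1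
    (TriangleMap.volume_eq_zero_of_cone (TriangleMap.volume_cone_iterate_pullback
      (TriangleMap.volume_cone_noZeroBlock (d := d)) k))
  filter_upwards [this, TriangleMap.ae_iterate_mem_digitDomain (d := d)] with x hx hx' hs
  have hD := hx' hs
  refine TriangleMap.weaklyConvergesAt_of_zero_blocks
    (b := fun k => TriangleMap.digit d ((TriangleMap.triangleMap d)^[k] x))
    (fun k => TriangleMap.mem_subsimplex_digit (hD k).1 (hD k).2) fun k => ?_
  -- If no block started at time `k` or later, the `k`-th iterate of `x` would lie in `noZeroBlock
  -- d`, against the choice of `x`.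
  by_contra! hcon
  refine hx k (TriangleMap.mem_iterate_pullback (fun i _ => hD i) fun j => ⟨?_, fun h => ?_⟩)
  · rw [← Function.iterate_add_apply]
    exact hD _
  · obtain ⟨i, hi, hne⟩ := hcon (k + j) (by lia)
    refine hne ?_
    have := h i hi
    rwa [← Function.iterate_add_apply, ← Function.iterate_add_apply,
      show i + j + k = k + j + i by lia] at this
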